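/- Let $(M,\tau)$ be a von Neumann algebra with a faithful normal tracial state, and let $A,B\subset N\subset M$ be (unital) von Neumann subalgebras. Write $\|x\|_2=\tau(x^*x)^{1/2}$, let $L^2(M)$ be the completion of $M$ for $\|\cdot\|_2$ with its left and right actions of $M$, let $L^2(N)\subset L^2(M)$ be the closure of $N$, let $E_B,E_N$ be the $\tau$-preserving conditional expectations, and let $(P)_1$ be the operator-norm unit ball of $P$. Let $\mathcal H\subset L^2(M)\ominus L^2(N)$ be a closed subspace stable under the left and right actions of $N$, and assume that $\mathcal H$ is compact relative to $B\subset N$ as an $A$-$A$ bimodule: whenever $x_n\in(A)_1$ is a sequence with $\|E_B(yx_nz)\|_2\to0$ for all $y,z\in N$, then $\langle x_n\xi y_n,\xi\rangle\to0$ for every sequence $y_n\in(A)_1$ and every $\xi\in\mathcal H$. Let $(\phi_t)_{t\ge0}$ be a symmetric semigroup on $N$, that is, linear maps $\phi_t:N\to N$ with $\phi_0=\mathrm{id}$, $\phi_{s+t}=\phi_s\phi_t$ and $\tau(\phi_t(x)y)=\tau(x\phi_t(y))$ for all $x,y\in N$, and let $\alpha_t:N\to M$ ($t\ge0$) be unital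 $*$-homomorphisms dilating it, that is, $E_N(\alpha_t(x))=\phi_t(x)$ for all $x\in N$ and $t\ge 0$ (so that the $\phi_t$ are automatically unital and completely positive). Assume that $\alpha_t(x)-\phi_t(x)\in\mathcal H$ for all $x\in N$ and $t\ge0$. Suppose that $A$ does not embed into $B$ inside $N$, that is, there is a sequence of unitaries $u_k\in A$ with $\|E_B(a^*u_kb)\|_2\to0$ for all $a,b\in N$. If $$\lim_{t\to0^+}\ \sup_{x\in(A)_1}\|\alpha_t(x)-x\|_2=0,$$ then $$\lim_{t\to0^+}\ \sup_{x\in(\mathcal N_N(A)'')_1}\|\alpha_t(x)-x\|_2=0,$$ where $\mathcal N_N(A)=\{u\in N\text{ unitary}: uAu^*=A\}$ and $\mathcal N_N(A)''$ is the von Neumann algebra it generates. -/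

import Mathlib

open Filter Topology
open scoped NNReal InnerProductSpace

noncomputable section

universe u

/-- A faithful normal tracial state on a von Neumann algebra `M ⊆ B(K)`.  Normality is expressed by
a density operator: `τ` is a sum of vector functionals `∑ ⟨ξₙ, · ξₙ⟩` with `∑ ‖ξₙ‖² < ∞`.
Positivity of `τ` is part of this. -/
structure TracialState {K : Type u} [NormedAddCommGroup K] [InnerProductSpace ℂ K]
    [CompleteSpace K] (M : VonNeumannAlgebra K) where
  toLinearMap : M.toStarSubalgebra →ₗ[ℂ] ℂ
  map_one : toLinearMap 1 = 1
  map_mul_comm : ∀ x y : M.toStarSubalgebra, toLinearMap (x * y) = toLinearMap (y * x)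
  faithful : ∀ x : M.toStarSubalgebra, toLinearMap (star x * x) = 0 → x = 0
  normal : ∃ ξ : ℕ → K, (Summable fun n => ‖ξ n‖ ^ 2) ∧
    ∀ x : M.toStarSubalgebra,
      HasSum (fun n => ⟪ξ n, (x : K →L[ℂ] K) (ξ n)⟫_ℂ) (toLinearMap x)

namespace TracialState

variable {K : Type u} [NormedAddCommGroup K] [InnerProductSpace ℂ K] [CompleteSpace K]
  {M : VonNeumannAlgebra K} (τ : TracialState M)

instance : CoeFun (TracialState M) (fun _ => M.toStarSubalgebra → ℂ) := ⟨fun τ => τ.toLinearMap⟩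

theorem exists_hasSum_star_mul : ∃ ξ : ℕ → K, ∀ x y : M.toStarSubalgebra,
    HasSum (fun n => ⟪(x : K →L[ℂ] K) (ξ n), (y : K →L[ℂ] K) (ξ n)⟫_ℂ) (τ (star x * y)) := by
  obtain ⟨ξ, -, h⟩ := τ.normal
  refine ⟨ξ, fun x y => ?_⟩
  have := h (star x * y)
  simpa [ContinuousLinearMap.star_eq_adjoint, ContinuousLinearMap.adjoint_inner_right] using this

theorem hasSum_norm_sq {ξ : ℕ → K} (h : ∀ x y : M.toStarSubalgebra,
    HasSum (fun n => ⟪(x : K →L[ℂ] K) (ξ n), (y : K →L[ℂ] K) (ξ n)⟫_ℂ) (τ (star x * y)))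
    (x : M.toStarSubalgebra) :
    HasSum (fun n => ‖(x : K →L[ℂ] K) (ξ n)‖ ^ 2) (τ (star x * x)).re := by
  have := Complex.hasSum_re (h x x)
  refine this.congr_fun fun n => ?_
  rw [← inner_self_eq_norm_sq (𝕜 := ℂ)]
  rfl

/-- `M` as a vector space, to be equipped with the inner product `⟨x, y⟩ = τ (x* y)`. -/
def PreL2 (_τ : TracialState M) : Type u := M.toStarSubalgebra

instance : AddCommGroup τ.PreL2 := inferInstanceAs (AddCommGroup M.toStarSubalgebra)
instance : Module ℂ τ.PreL2 := inferInstanceAs (Module ℂ M.toStarSubalgebra)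

/-- The identity map from `M` to `PreL2`. -/
def toPreL2 : M.toStarSubalgebra ≃ₗ[ℂ] τ.PreL2 := LinearEquiv.refl ℂ _

/-- The inner product `⟨x, y⟩ = τ (x* y)` on `M`. -/
abbrev preL2Core : InnerProductSpace.Core ℂ τ.PreL2 where
  inner a b := τ (star (τ.toPreL2.symm a) * τ.toPreL2.symm b)
  conj_inner_symm a b := by
    obtain ⟨ξ, h⟩ := τ.exists_hasSum_star_mul
    refine HasSum.unique ?_ (h _ _)
    have := (Complex.hasSum_conj'.2 (h (τ.toPreL2.symm b) (τ.toPreL2.symm a)))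
    simpa using this
  re_inner_nonneg a := by
    obtain ⟨ξ, h⟩ := τ.exists_hasSum_star_mul
    exact (τ.hasSum_norm_sq h _).nonneg fun n => by positivity
  add_left a b c := by simp [add_mul]
  smul_left a b c := by simp
  definite a h := τ.faithful _ h

instance : NormedAddCommGroup τ.PreL2 :=
  InnerProductSpace.Core.toNormedAddCommGroup (cd := τ.preL2Core)

instance : InnerProductSpace ℂ τ.PreL2 := InnerProductSpace.ofCore τ.preL2Core.toCore

theorem preL2_inner_def (a b : τ.PreL2) :
    ⟪a, b⟫_ℂ = τ (star (τ.toPreL2.symm a) * τ.toPreL2.symm b) := rfl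

theorem preL2_norm_sq (a : τ.PreL2) :
    ‖a‖ ^ 2 = (τ (star (τ.toPreL2.symm a) * τ.toPreL2.symm a)).re := by
  rw [← inner_self_eq_norm_sq (𝕜 := ℂ)]
  rfl

/-- The Hilbert space `L²(M, τ)`: the completion of `M` for `‖x‖₂ = τ (x* x)^(1/2)`. -/
abbrev L2 : Type u := UniformSpace.Completion τ.PreL2

/-- The canonical embedding `M → L²(M, τ)`. -/
def toL2 : M.toStarSubalgebra →ₗ[ℂ] τ.L2 :=
  (UniformSpace.Completion.toComplL (𝕜 := ℂ) (E := τ.PreL2)).toLinearMap ∘ₗ τ.toPreL2.toLinearMap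

theorem preL2_norm_mul_le (x : M.toStarSubalgebra) (a : τ.PreL2) :
    ‖τ.toPreL2 (x * τ.toPreL2.symm a)‖ ≤ ‖x‖ * ‖a‖ := by
  obtain ⟨ξ, h⟩ := τ.exists_hasSum_star_mul
  refine le_of_sq_le_sq ?_ (by positivity)
  rw [mul_pow, preL2_norm_sq, preL2_norm_sq]
  refine hasSum_le (fun n => ?_) (τ.hasSum_norm_sq h _)
    ((τ.hasSum_norm_sq h (τ.toPreL2.symm a)).mul_left (‖x‖ ^ 2))
  rw [← mul_pow]
  gcongr
  exact (x : K →L[ℂ] K).le_opNorm _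

theorem preL2_norm_star (x : M.toStarSubalgebra) :
    ‖τ.toPreL2 (star x)‖ = ‖τ.toPreL2 x‖ := by
  have : ‖τ.toPreL2 (star x)‖ ^ 2 = ‖τ.toPreL2 x‖ ^ 2 := by
    rw [preL2_norm_sq, preL2_norm_sq]
    simp [τ.map_mul_comm x (star x)]
  exact (sq_eq_sq₀ (norm_nonneg _) (norm_nonneg _)).1 this

theorem preL2_norm_mul_le' (y : M.toStarSubalgebra) (a : τ.PreL2) :
    ‖τ.toPreL2 (τ.toPreL2.symm a * y)‖ ≤ ‖y‖ * ‖a‖ := by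
  have h := τ.preL2_norm_mul_le (star y) (τ.toPreL2 (star (τ.toPreL2.symm a)))
  rw [preL2_norm_star] at h
  rw [← preL2_norm_star, star_mul]
  simpa using h

/-- The left action `ξ ↦ x ξ` of `x ∈ M` on `L²(M, τ)`. -/
def leftMul (x : M.toStarSubalgebra) : τ.L2 →L[ℂ] τ.L2 :=
  ((τ.toPreL2.toLinearMap ∘ₗ LinearMap.mulLeft ℂ x ∘ₗ
    τ.toPreL2.symm.toLinearMap).mkContinuous ‖x‖ (τ.preL2_norm_mul_le x)).completion

/-- The right action `ξ ↦ ξ y` of `y ∈ M` on `L²(M, τ)`. -/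
def rightMul (y : M.toStarSubalgebra) : τ.L2 →L[ℂ] τ.L2 :=
  ((τ.toPreL2.toLinearMap ∘ₗ LinearMap.mulRight ℂ y ∘ₗ
    τ.toPreL2.symm.toLinearMap).mkContinuous ‖y‖ (τ.preL2_norm_mul_le' y)).completion

theorem inner_toL2 (x y : M.toStarSubalgebra) :
    ⟪τ.toL2 x, τ.toL2 y⟫_ℂ = τ (star x * y) :=
  UniformSpace.Completion.inner_coe (𝕜 := ℂ) (τ.toPreL2 x) (τ.toPreL2 y)

theorem leftMul_toL2 (x y : M.toStarSubalgebra) : τ.leftMul x (τ.toL2 y) = τ.toL2 (x * y) :=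
  ContinuousLinearMap.completion_apply_coe _ (τ.toPreL2 y)

theorem rightMul_toL2 (x y : M.toStarSubalgebra) : τ.rightMul y (τ.toL2 x) = τ.toL2 (x * y) :=
  ContinuousLinearMap.completion_apply_coe _ (τ.toPreL2 x)

/-- The closed subspace `L²(P) ⊆ L²(M)` of a von Neumann subalgebra `P ⊆ M`. -/
def subL2 (P : VonNeumannAlgebra K) : Submodule ℂ τ.L2 :=
  ((P.toStarSubalgebra.toSubalgebra.toSubmodule.comap
    M.toStarSubalgebra.toSubalgebra.val.toLinearMap).map τ.toL2).topologicalClosure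

instance (P : VonNeumannAlgebra K) : (τ.subL2 P).HasOrthogonalProjection :=
  haveI : CompleteSpace (τ.subL2 P) :=
    (Submodule.isClosed_topologicalClosure _).completeSpace_coe
  inferInstance

/-- The trace preserving conditional expectation `E_P(x)` of `x ∈ M` onto a von Neumann subalgebra
`P ⊆ M`, regarded as an element of `L²(M)`: the orthogonal projection of `x` onto `L²(P)`. -/
def condExp (P : VonNeumannAlgebra K) (x : M.toStarSubalgebra) : τ.L2 :=
  (τ.subL2 P).starProjection (τ.toL2 x)

/-- For von Neumann subalgebras `A, B ⊆ N ⊆ M`: `A` embeds into `B` inside `N`, i.e. there is no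
sequence of unitaries `uₖ ∈ A` with `‖E_B(a* uₖ b)‖₂ → 0` for all `a, b ∈ N`. -/
def EmbedsInside (A B N : VonNeumannAlgebra K) : Prop :=
  ¬ ∃ u : ℕ → M.toStarSubalgebra,
    (∀ k, (u k : K →L[ℂ] K) ∈ A ∧ u k ∈ unitary M.toStarSubalgebra) ∧
    ∀ a b : M.toStarSubalgebra, (a : K →L[ℂ] K) ∈ N → (b : K →L[ℂ] K) ∈ N →
      Tendsto (fun k => ‖τ.condExp B (star a * u k * b)‖) atTop (𝓝 0)

/-- A closed subspace of `L²(M)` that is stable under the left and right actions of `N ⊆ M`. -/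
structure IsHilbertBimodule (N : VonNeumannAlgebra K) (H : Submodule ℂ τ.L2) : Prop where
  isClosed : IsClosed (H : Set τ.L2)
  leftMul_mem : ∀ x : M.toStarSubalgebra, (x : K →L[ℂ] K) ∈ N → ∀ ξ ∈ H, τ.leftMul x ξ ∈ H
  rightMul_mem : ∀ x : M.toStarSubalgebra, (x : K →L[ℂ] K) ∈ N → ∀ ξ ∈ H, τ.rightMul x ξ ∈ H

/-- `H` is compact relative to `B ⊆ N` as an `A`-`A` bimodule: if `xₙ ∈ (A)₁` and
`‖E_B(y xₙ z)‖₂ → 0` for all `y, z ∈ N`, then `⟨xₙ ξ yₙ, ξ⟩ → 0` for all `yₙ ∈ (A)₁`, `ξ ∈ H`. -/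
def IsCompactRelative (A B N : VonNeumannAlgebra K) (H : Submodule ℂ τ.L2) : Prop :=
  ∀ x : ℕ → M.toStarSubalgebra, (∀ n, (x n : K →L[ℂ] K) ∈ A ∧ ‖x n‖ ≤ 1) →
    (∀ y z : M.toStarSubalgebra, (y : K →L[ℂ] K) ∈ N → (z : K →L[ℂ] K) ∈ N →
      Tendsto (fun n => ‖τ.condExp B (y * x n * z)‖) atTop (𝓝 0)) →
    ∀ y : ℕ → M.toStarSubalgebra, (∀ n, (y n : K →L[ℂ] K) ∈ A ∧ ‖y n‖ ≤ 1) → ∀ ξ ∈ H,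
      Tendsto (fun n => ⟪ξ, τ.leftMul (x n) (τ.rightMul (y n) ξ)⟫_ℂ) atTop (𝓝 0)

end TracialState

/-- The inclusion `N → M` of von Neumann algebras on the same Hilbert space. -/
def VonNeumannAlgebra.incl {K : Type u} [NormedAddCommGroup K] [InnerProductSpace ℂ K]
    [CompleteSpace K] {N M : VonNeumannAlgebra K} (h : N ≤ M) :
    N.toStarSubalgebra →⋆ₐ[ℂ] M.toStarSubalgebra :=
  StarSubalgebra.inclusion (S₁ := N.toStarSubalgebra) (S₂ := M.toStarSubalgebra) h

/-- A one-parameter semigroup `(φ_t)_{t ≥ 0}` of linear maps on `N ⊆ M` that is symmetric for the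
trace: `τ(φ_t(x) y) = τ(x φ_t(y))`.  Complete positivity and contractivity of `φ_t` are not listed:
they follow when `φ_t = E_N ∘ α_t` for `*`-homomorphisms `α_t`. -/
structure IsSymmetricSemigroup {K : Type u} [NormedAddCommGroup K] [InnerProductSpace ℂ K]
    [CompleteSpace K] {N M : VonNeumannAlgebra K} (h : N ≤ M) (τ : TracialState M)
    (φ : ℝ≥0 → N.toStarSubalgebra →ₗ[ℂ] N.toStarSubalgebra) : Prop where
  zero : φ 0 = LinearMap.id
  add : ∀ s t, φ (s + t) = φ s ∘ₗ φ t
  symm : ∀ t x y, τ (VonNeumannAlgebra.incl h (φ t x * y)) = τ (VonNeumannAlgebra.incl h (x * φ t y))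

/-- The `*`-homomorphisms `α_t : N → M` dilate `φ_t`: `E_N(α_t(x)) = φ_t(x)`. -/
def IsDilation {K : Type u} [NormedAddCommGroup K] [InnerProductSpace ℂ K]
    [CompleteSpace K] {N M : VonNeumannAlgebra K} (h : N ≤ M) (τ : TracialState M)
    (α : ℝ≥0 → N.toStarSubalgebra →⋆ₐ[ℂ] M.toStarSubalgebra)
    (φ : ℝ≥0 → N.toStarSubalgebra →ₗ[ℂ] N.toStarSubalgebra) : Prop :=
  ∀ t x, τ.condExp N (α t x) = τ.toL2 (VonNeumannAlgebra.incl h (φ t x))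

/-- The normalizer `𝒩_N(A) = {u ∈ 𝒰(N) : u A u* = A}`, as a set of operators. -/
def normalizerSet {K : Type u} [NormedAddCommGroup K] [InnerProductSpace ℂ K]
    [CompleteSpace K] (N A : VonNeumannAlgebra K) : Set (K →L[ℂ] K) :=
  {u | u ∈ N ∧ u ∈ unitary (K →L[ℂ] K) ∧
    (fun a => u * a * star u) '' (A : Set (K →L[ℂ] K)) = (A : Set (K →L[ℂ] K))}

/-- `α_t → id` as `t → 0⁺`, uniformly in `‖·‖₂` on the operator-norm unit ball of `S ⊆ N`. -/
def ConvergesUniformlyOnBall {K : Type u} [NormedAddCommGroup K] [InnerProductSpace ℂ K]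
    [CompleteSpace K] {N M : VonNeumannAlgebra K} (h : N ≤ M) (τ : TracialState M)
    (α : ℝ≥0 → N.toStarSubalgebra →⋆ₐ[ℂ] M.toStarSubalgebra) (S : Set (K →L[ℂ] K)) : Prop :=
  TendstoUniformlyOn (fun t x => τ.toL2 (α t x)) (fun x => τ.toL2 (VonNeumannAlgebra.incl h x))
    (𝓝[>] 0) {x : N.toStarSubalgebra | (x : K →L[ℂ] K) ∈ S ∧ ‖x‖ ≤ 1}

end

/-! Let w normalize A and let δ = α_t(w) - φ_t(w), a vector of H and so orthogonal to L²(N). If u ∈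
A is unitary, so is a = w u w* ∈ A, and α_t(a) α_t(w) = α_t(w) α_t(u). Hence, if α_t is ε-close to
the identity on (A)₁, then α_t(w) u - a α_t(w) has 2-norm at most 2ε; its component orthogonal to
L²(N) is δu - aδ, so ‖δ - a δ u*‖ ≤ 2ε. Along the unitaries witnessing that A does not embed into B,
relative compactness of H gives ⟨a δ u*, δ⟩ → 0, whence ‖δ‖ ≤ 2ε, uniformly in w
(`norm_toL2_sub_le_of_mem_normalizerSet`).

Symmetry of the semigroup turns this into a bound on α_{2t}(w) - w (`IsDilation.norm_sq_sub_eq`),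
still uniform over the group of normalizing unitaries.

To reach the generated von Neumann algebra, average the vectors u* α(u) over the group: this yields
ξ close to 1 with u ξ = ξ α(u). By normality of the trace the relation passes to the bicommutant,
where α(x) - x = x(ξ - 1) - (ξ - 1)α(x) is small on the unit ball
(`norm_toL2_starAlgHom_sub_le_of_mem_bicommutant`). -/

/-- A family of linear contractions that preserves a bounded set `S` of a Hilbert space has a
common fixed point in every closed ball containing `S`: the vector of least norm in the closed
convex hull of `S`. -/
theorem exists_fixed_mem_closedBall {E : Type*} [NormedAddCommGroup E] [InnerProductSpace ℂ E]
    [CompleteSpace E] {S : Set E} (hS : S.Nonempty) {e : E} {c : ℝ}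
    (hSc : S ⊆ Metric.closedBall e c) {ι : Type*} (T : ι → E →L[ℂ] E)
    (hT : ∀ i ξ, ‖T i ξ‖ ≤ ‖ξ‖) (hTS : ∀ i, ∀ ξ ∈ S, T i ξ ∈ S) :
    ∃ ξ ∈ Metric.closedBall e c, ∀ i, T i ξ = ξ := by
  let : InnerProductSpace ℝ E := InnerProductSpace.rclikeToReal ℂ E
  let C : Set E := closure (convexHull ℝ S)
  have hconv : Convex ℝ C := (convex_convexHull ℝ S).closure
  have hTC : ∀ i, ∀ ξ ∈ C, T i ξ ∈ C := by
    intro i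
    refine Set.MapsTo.closure (f := T i) (s := convexHull ℝ S) (t := convexHull ℝ S) ?_
      (T i).continuous
    have hpre : Convex ℝ ((T i) ⁻¹' convexHull ℝ S) :=
      (convex_convexHull ℝ S).linear_preimage ((T i).toLinearMap.restrictScalars ℝ)
    exact convexHull_min (fun ξ hξ => subset_convexHull ℝ S (hTS i ξ hξ)) hpre
  obtain ⟨ξ, hξC, hξ⟩ := exists_norm_eq_iInf_of_complete_convex
    (hS.mono (subset_convexHull ℝ S) |>.closure) isClosed_closure.isComplete hconv 0
  have hmin : ∀ w ∈ C, ‖ξ‖ ≤ ‖w‖ := by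
    intro w hw
    have h := ciInf_le (f := fun w : C => ‖(0 : E) - w‖)
      ⟨0, Set.forall_mem_range.2 fun _ => norm_nonneg _⟩ ⟨w, hw⟩
    rw [← hξ] at h
    simpa using h
  refine ⟨ξ, ?_, fun i => ?_⟩
  · exact closure_minimal (convexHull_min hSc (convex_closedBall e c)) Metric.isClosed_closedBall hξC
  · by_contra hne
    have heq : ‖T i ξ‖ = ‖ξ‖ := le_antisymm (hT i ξ) (hmin _ (hTC i ξ hξC))
    -- Strict convexity: if T ξ and ξ were distinct with equal norms, their midpoint would lie in C
    -- with smaller norm.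
    have hlt := (norm_midpoint_lt_iff heq).2 hne
    rw [heq, smul_add] at hlt
    exact absurd (hmin _ (hconv (hTC i ξ hξC) hξC (by norm_num) (by norm_num) (by norm_num)))
      (not_le.2 hlt)

/-! ### Bicommutant density through the infinite amplification. -/

section Amplification

variable {K : Type*} [NormedAddCommGroup K]

theorem memℓp_two_iff_summable_sq {f : ℕ → K} : Memℓp f 2 ↔ Summable fun n => ‖f n‖ ^ 2 := by
  simpa using memℓp_gen_iff (p := 2) (E := fun _ : ℕ => K) (f := f) (by norm_num)

theorem lp_two_hasSum_norm_sq (f : lp (fun _ : ℕ => K) 2) :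
    HasSum (fun n => ‖f n‖ ^ 2) (‖f‖ ^ 2) := by
  simpa using lp.hasSum_norm (p := 2) (by norm_num) f

variable [InnerProductSpace ℂ K]

theorem summable_norm_sq_apply (T : K →L[ℂ] K) {f : ℕ → K} (hf : Summable fun n => ‖f n‖ ^ 2) :
    Summable fun n => ‖T (f n)‖ ^ 2 := by
  refine .of_nonneg_of_le (fun n => by positivity) (fun n => ?_) (hf.mul_left (‖T‖ ^ 2))
  rw [← mul_pow]
  gcongr
  exact T.le_opNorm _

/-- The diagonal operator `T ⊕ T ⊕ ⋯` on `ℓ²(ℕ, K)`. -/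
noncomputable def amplify (T : K →L[ℂ] K) :
    lp (fun _ : ℕ => K) 2 →L[ℂ] lp (fun _ : ℕ => K) 2 :=
  LinearMap.mkContinuous
    { toFun := fun f => ⟨fun n => T (f n), memℓp_two_iff_summable_sq.2
        (summable_norm_sq_apply T (memℓp_two_iff_summable_sq.1 (lp.memℓp f)))⟩
      map_add' := fun f g => by ext n; exact map_add T (f n) (g n)
      map_smul' := fun c f => by ext n; simp } ‖T‖ fun f => by
    refine le_of_sq_le_sq ?_ (by positivity)
    rw [mul_pow]
    refine hasSum_le (fun n => ?_) (lp_two_hasSum_norm_sq _)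
      ((lp_two_hasSum_norm_sq f).mul_left (‖T‖ ^ 2))
    rw [← mul_pow]
    gcongr
    exact T.le_opNorm _

@[simp]
theorem amplify_apply (T : K →L[ℂ] K) (f : lp (fun _ : ℕ => K) 2) (n : ℕ) :
    amplify T f n = T (f n) := rfl

theorem amplify_single (T : K →L[ℂ] K) (j : ℕ) (v : K) :
    amplify T (lp.single 2 j v) = lp.single 2 j (T v) := by
  ext n
  by_cases h : n = j
  · subst h; simp
  · rw [amplify_apply, lp.single_apply_ne _ _ _ h, lp.single_apply_ne _ _ _ h, map_zero]

variable [CompleteSpace K]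

theorem inner_amplify_left (T : K →L[ℂ] K) (f g : lp (fun _ : ℕ => K) 2) :
    ⟪amplify T f, g⟫_ℂ = ⟪f, amplify (star T) g⟫_ℂ := by
  simp [lp.inner_eq_tsum, ContinuousLinearMap.star_eq_adjoint,
    ContinuousLinearMap.adjoint_inner_right]

/-- The bicommutant density theorem: the linear span of a self-adjoint multiplicative set `G ∋ 1`
is dense in the bicommutant of `G`, for the seminorms `∑ ‖T ξₙ‖²`. -/
theorem exists_mem_span_tsum_lt_of_mem_bicommutant {G : Set (K →L[ℂ] K)} (h1 : 1 ∈ G)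
    (hmul : ∀ a ∈ G, ∀ b ∈ G, a * b ∈ G) (hstar : ∀ a ∈ G, star a ∈ G) {x : K →L[ℂ] K}
    (hx : x ∈ G.centralizer.centralizer) {ξ : ℕ → K} (hξ : Summable fun n => ‖ξ n‖ ^ 2)
    {ε : ℝ} (hε : 0 < ε) :
    ∃ s ∈ Submodule.span ℂ G, ∑' n, ‖(x - s) (ξ n)‖ ^ 2 < ε ^ 2 := by
  let Ξ : lp (fun _ : ℕ => K) 2 := ⟨ξ, memℓp_two_iff_summable_sq.2 hξ⟩
  let J : (K →L[ℂ] K) →ₗ[ℂ] lp (fun _ : ℕ => K) 2 :=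
    { toFun := fun T => amplify T Ξ
      map_add' := fun S T => by ext n; simp
      map_smul' := fun c T => by ext n; simp }
  let V : Submodule ℂ (lp (fun _ : ℕ => K) 2) :=
    ((Submodule.span ℂ G).map J).topologicalClosure
  have : CompleteSpace V := (Submodule.isClosed_topologicalClosure _).completeSpace_coe
  have hGspan : ∀ g ∈ G, ∀ s ∈ Submodule.span ℂ G, g * s ∈ Submodule.span ℂ G := by
    intro g hg s hs
    induction hs using Submodule.span_induction with
    | mem s hs => exact Submodule.subset_span (hmul g hg s hs)
    | zero => simp
    | add s t _ _ h₁ h₂ => rw [mul_add]; exact add_mem h₁ h₂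
    | smul c s _ h => rw [mul_smul_comm]; exact Submodule.smul_mem _ c h
  have hGV : ∀ g ∈ G, ∀ f ∈ V, amplify g f ∈ V := by
    intro g hg
    refine Set.MapsTo.closure (f := amplify g) (s := (Submodule.span ℂ G).map J)
      (t := (Submodule.span ℂ G).map J) ?_ (amplify g).continuous
    rintro _ ⟨s, hs, rfl⟩
    exact ⟨g * s, hGspan g hg s hs, rfl⟩
  have hGV' : ∀ g ∈ G, ∀ f ∈ Vᗮ, amplify g f ∈ Vᗮ := by
    intro g hg f hf
    rw [Submodule.mem_orthogonal'] at hf ⊢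
    intro v hv
    rw [inner_amplify_left]
    exact hf _ (hGV _ (hstar g hg) v hv)
  have hcommG : ∀ g ∈ G, ∀ f, V.starProjection (amplify g f) = amplify g (V.starProjection f) := by
    intro g hg f
    refine Submodule.eq_starProjection_of_mem_of_inner_eq_zero
      (hGV g hg _ (Submodule.starProjection_apply_mem V f)) ?_
    intro w hw
    rw [← map_sub]
    exact (Submodule.mem_orthogonal' _ _).1
      (hGV' g hg _ (Submodule.sub_starProjection_mem_orthogonal f)) w hw
  -- The matrix entries of the projection onto V commute with G because the projection commutes with
  -- the amplification of G; so x, being in the bicommutant, commutes with every entry.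
  have hentry : ∀ i j v, (V.starProjection (lp.single 2 j (x v)) : lp (fun _ : ℕ => K) 2) i =
      x ((V.starProjection (lp.single 2 j v) : lp (fun _ : ℕ => K) 2) i) := by
    intro i j v
    let T : K →L[ℂ] K := lp.evalCLM ℂ (fun _ : ℕ => K) 2 i ∘L V.starProjection ∘L
      lp.singleContinuousLinearMap ℂ (fun _ : ℕ => K) 2 j
    have hT : T ∈ G.centralizer := by
      rw [Set.mem_centralizer_iff]
      intro g hg
      ext w
      change g ((V.starProjection (lp.single 2 j w) : lp (fun _ : ℕ => K) 2) i) =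
        (V.starProjection (lp.single 2 j (g w)) : lp (fun _ : ℕ => K) 2) i
      rw [← amplify_single, hcommG g hg, amplify_apply]
    exact DFunLike.congr_fun (Set.mem_centralizer_iff.1 hx T hT) v
  have hcomm : V.starProjection ∘L amplify x = amplify x ∘L V.starProjection := by
    refine lp.ext_continuousLinearMap (by norm_num) fun j => ?_
    ext v i
    simp [amplify_single, hentry]
  have hΞV : Ξ ∈ V := Submodule.le_topologicalClosure _ ⟨1, Submodule.subset_span h1, rfl⟩
  have hxV : amplify x Ξ ∈ V := by
    have := DFunLike.congr_fun hcomm Ξ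
    simp only [ContinuousLinearMap.comp_apply, Submodule.starProjection_eq_self_iff.2 hΞV] at this
    exact Submodule.starProjection_eq_self_iff.1 this
  obtain ⟨_, ⟨s, hs, rfl⟩, hlt⟩ := Metric.mem_closure_iff.1 hxV ε hε
  refine ⟨s, hs, ?_⟩
  rw [dist_eq_norm] at hlt
  have h := (lp_two_hasSum_norm_sq (amplify x Ξ - J s)).tsum_eq
  have h' : ∑' n, ‖(x - s) (ξ n)‖ ^ 2 = ‖amplify x Ξ - J s‖ ^ 2 := h
  rw [h']
  gcongr

end Amplification

/-! ### The bimodule structure of L²(M). -/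

namespace TracialState

universe u

variable {K : Type u} [NormedAddCommGroup K] [InnerProductSpace ℂ K] [CompleteSpace K]
  {M : VonNeumannAlgebra K} (τ : TracialState M)

theorem norm_toL2 (x : M.toStarSubalgebra) : ‖τ.toL2 x‖ = ‖τ.toPreL2 x‖ :=
  UniformSpace.Completion.norm_coe (τ.toPreL2 x)

theorem norm_toL2_sq (x : M.toStarSubalgebra) : ‖τ.toL2 x‖ ^ 2 = (τ (star x * x)).re := by
  rw [norm_toL2, preL2_norm_sq]
  rfl

theorem norm_toL2_star (x : M.toStarSubalgebra) : ‖τ.toL2 (star x)‖ = ‖τ.toL2 x‖ := by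
  rw [norm_toL2, norm_toL2, preL2_norm_star]

theorem norm_toL2_mul_le_left (x y : M.toStarSubalgebra) :
    ‖τ.toL2 (x * y)‖ ≤ ‖x‖ * ‖τ.toL2 y‖ := by
  simpa [norm_toL2] using τ.preL2_norm_mul_le x (τ.toPreL2 y)

theorem norm_toL2_mul_le_right (x y : M.toStarSubalgebra) :
    ‖τ.toL2 (x * y)‖ ≤ ‖y‖ * ‖τ.toL2 x‖ := by
  simpa [norm_toL2] using τ.preL2_norm_mul_le' y (τ.toPreL2 x)

theorem toL2_injective : Function.Injective τ.toL2 := by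
  intro x y h
  rw [← sub_eq_zero, ← map_sub] at h
  refine sub_eq_zero.1 (τ.faithful _ ?_)
  rw [← inner_toL2, h, inner_zero_left]

theorem trace_star (x : M.toStarSubalgebra) : τ (star x) = star (τ x) := by
  have h := inner_conj_symm (𝕜 := ℂ) (τ.toL2 x) (τ.toL2 1)
  simp only [inner_toL2, star_one, one_mul, mul_one] at h
  exact h.symm

theorem denseRange_toL2 : DenseRange τ.toL2 :=
  UniformSpace.Completion.denseRange_coe (α := τ.PreL2)

/-- Bounded operators on `L²(M)` that agree on `M` are equal. -/
theorem clm_ext {S T : τ.L2 →L[ℂ] τ.L2} (h : ∀ x, S (τ.toL2 x) = T (τ.toL2 x)) : S = T :=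
  DFunLike.coe_injective (τ.denseRange_toL2.equalizer S.continuous T.continuous (funext h))

theorem leftMul_add (x y : M.toStarSubalgebra) :
    τ.leftMul (x + y) = τ.leftMul x + τ.leftMul y :=
  τ.clm_ext fun z => by simp [leftMul_toL2, add_mul]

theorem leftMul_smul (c : ℂ) (x : M.toStarSubalgebra) :
    τ.leftMul (c • x) = c • τ.leftMul x :=
  τ.clm_ext fun z => by simp [leftMul_toL2]

theorem rightMul_add (x y : M.toStarSubalgebra) :
    τ.rightMul (x + y) = τ.rightMul x + τ.rightMul y :=
  τ.clm_ext fun z => by simp [rightMul_toL2, mul_add]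

theorem rightMul_smul (c : ℂ) (x : M.toStarSubalgebra) :
    τ.rightMul (c • x) = c • τ.rightMul x :=
  τ.clm_ext fun z => by simp [rightMul_toL2]

theorem leftMul_leftMul (x y : M.toStarSubalgebra) (ξ : τ.L2) :
    τ.leftMul x (τ.leftMul y ξ) = τ.leftMul (x * y) ξ :=
  DFunLike.congr_fun (τ.clm_ext (S := τ.leftMul x ∘L τ.leftMul y) fun z => by
    simp [leftMul_toL2, mul_assoc]) ξ

theorem rightMul_rightMul (x y : M.toStarSubalgebra) (ξ : τ.L2) :
    τ.rightMul x (τ.rightMul y ξ) = τ.rightMul (y * x) ξ :=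
  DFunLike.congr_fun (τ.clm_ext (S := τ.rightMul x ∘L τ.rightMul y) fun z => by
    simp [rightMul_toL2, mul_assoc]) ξ

theorem leftMul_rightMul_comm (x y : M.toStarSubalgebra) (ξ : τ.L2) :
    τ.leftMul x (τ.rightMul y ξ) = τ.rightMul y (τ.leftMul x ξ) :=
  DFunLike.congr_fun (τ.clm_ext (S := τ.leftMul x ∘L τ.rightMul y)
    (T := τ.rightMul y ∘L τ.leftMul x) fun z => by
      simp [leftMul_toL2, rightMul_toL2, mul_assoc]) ξ

theorem leftMul_one : τ.leftMul 1 = ContinuousLinearMap.id ℂ τ.L2 :=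
  τ.clm_ext fun z => by simp [leftMul_toL2]

theorem rightMul_one : τ.rightMul 1 = ContinuousLinearMap.id ℂ τ.L2 :=
  τ.clm_ext fun z => by simp [rightMul_toL2]

theorem norm_leftMul_apply_le (x : M.toStarSubalgebra) (ξ : τ.L2) :
    ‖τ.leftMul x ξ‖ ≤ ‖x‖ * ‖ξ‖ :=
  τ.denseRange_toL2.induction_on ξ
    (isClosed_le (by fun_prop) (by fun_prop))
    fun z => by rw [leftMul_toL2]; exact τ.norm_toL2_mul_le_left x z

theorem norm_rightMul_apply_le (x : M.toStarSubalgebra) (ξ : τ.L2) :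
    ‖τ.rightMul x ξ‖ ≤ ‖x‖ * ‖ξ‖ :=
  τ.denseRange_toL2.induction_on ξ
    (isClosed_le (by fun_prop) (by fun_prop))
    fun z => by rw [rightMul_toL2]; exact τ.norm_toL2_mul_le_right z x

theorem inner_toL2_leftMul (x y : M.toStarSubalgebra) (ξ : τ.L2) :
    ⟪τ.toL2 y, τ.leftMul x ξ⟫_ℂ = ⟪τ.toL2 (star x * y), ξ⟫_ℂ :=
  τ.denseRange_toL2.induction_on ξ
    (isClosed_eq (by fun_prop) (by fun_prop))
    fun z => by simp [leftMul_toL2, inner_toL2, mul_assoc]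

theorem inner_toL2_rightMul (x y : M.toStarSubalgebra) (ξ : τ.L2) :
    ⟪τ.toL2 y, τ.rightMul x ξ⟫_ℂ = ⟪τ.toL2 (y * star x), ξ⟫_ℂ :=
  τ.denseRange_toL2.induction_on ξ
    (isClosed_eq (by fun_prop) (by fun_prop))
    fun z => by
      simp only [rightMul_toL2, inner_toL2, star_mul, star_star]
      rw [← mul_assoc, τ.map_mul_comm, mul_assoc]

/-- Against a bounded vector y the action of x is controlled by its 2-norm alone. Approximation in
2-norm therefore needs no operator-norm bound on the approximants. -/
theorem norm_inner_toL2_leftMul_le (x y : M.toStarSubalgebra) (ξ : τ.L2) :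
    ‖⟪τ.toL2 y, τ.leftMul x ξ⟫_ℂ‖ ≤ ‖τ.toL2 x‖ * (‖y‖ * ‖ξ‖) := by
  rw [inner_toL2_leftMul]
  refine (norm_inner_le_norm _ _).trans ?_
  have h := τ.norm_toL2_mul_le_right (star x) y
  rw [norm_toL2_star] at h
  nlinarith [norm_nonneg ξ]

theorem norm_inner_toL2_rightMul_le (x y : M.toStarSubalgebra) (ξ : τ.L2) :
    ‖⟪τ.toL2 y, τ.rightMul x ξ⟫_ℂ‖ ≤ ‖τ.toL2 x‖ * (‖y‖ * ‖ξ‖) := by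
  rw [inner_toL2_rightMul]
  refine (norm_inner_le_norm _ _).trans ?_
  have h := τ.norm_toL2_mul_le_left y (star x)
  rw [norm_toL2_star] at h
  nlinarith [norm_nonneg ξ]

theorem norm_le_one_of_mem_unitary {x : M.toStarSubalgebra}
    (hx : x ∈ unitary M.toStarSubalgebra) : ‖x‖ ≤ 1 := by
  have h : ‖x‖ * ‖x‖ = ‖(1 : K →L[ℂ] K)‖ := by
    have e : star (x : K →L[ℂ] K) * x = 1 :=
      congr_arg Subtype.val (Unitary.star_mul_self_of_mem hx)
    rw [← e]
    exact (CStarRing.norm_star_mul_self (x := (x : K →L[ℂ] K))).symm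
  have h1 : ‖(1 : K →L[ℂ] K)‖ ≤ 1 := ContinuousLinearMap.norm_id_le
  nlinarith [norm_nonneg x]

theorem toL2_mem_subL2 {P : VonNeumannAlgebra K} {x : M.toStarSubalgebra}
    (hx : (x : K →L[ℂ] K) ∈ P) : τ.toL2 x ∈ τ.subL2 P :=
  Submodule.le_topologicalClosure _ ⟨x, hx, rfl⟩

theorem inner_condExp {P : VonNeumannAlgebra K} {y : M.toStarSubalgebra}
    (hy : (y : K →L[ℂ] K) ∈ P) (x : M.toStarSubalgebra) :
    ⟪τ.toL2 y, τ.condExp P x⟫_ℂ = τ (star y * x) := by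
  rw [← inner_toL2, condExp, ← Submodule.inner_starProjection_left_eq_right,
    Submodule.starProjection_eq_self_iff.2 (τ.toL2_mem_subL2 hy)]

end TracialState

theorem VonNeumannAlgebra.isClosed {K : Type*} [NormedAddCommGroup K] [InnerProductSpace ℂ K]
    [CompleteSpace K] (N : VonNeumannAlgebra K) : IsClosed (N : Set (K →L[ℂ] K)) := by
  rw [← N.centralizer_centralizer]
  exact Set.isClosed_centralizer _

/-- Norm-closed `*`-subalgebras of B(K) are C*-algebras, and `*`-homomorphisms between those are
contractive. -/
theorem VonNeumannAlgebra.norm_starAlgHom_apply_le {K : Type*} [NormedAddCommGroup K]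
    [InnerProductSpace ℂ K] [CompleteSpace K] {N M : VonNeumannAlgebra K}
    (α : N.toStarSubalgebra →⋆ₐ[ℂ] M.toStarSubalgebra) (x : N.toStarSubalgebra) :
    ‖α x‖ ≤ ‖x‖ := by
  have : IsClosed (N.toStarSubalgebra : Set (K →L[ℂ] K)) := N.isClosed
  have : IsClosed (M.toStarSubalgebra : Set (K →L[ℂ] K)) := M.isClosed
  exact NonUnitalStarAlgHom.norm_apply_le α x

/-! ### Trace-preserving homomorphisms and intertwining vectors. -/

section Deformation

universe u

variable {K : Type u} [NormedAddCommGroup K] [InnerProductSpace ℂ K] [CompleteSpace K]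
  {M N : VonNeumannAlgebra K}

theorem norm_toL2_starAlgHom (hNM : N ≤ M) (τ : TracialState M)
    {α : N.toStarSubalgebra →⋆ₐ[ℂ] M.toStarSubalgebra}
    (hα : ∀ x, τ (α x) = τ (VonNeumannAlgebra.incl hNM x)) (x : N.toStarSubalgebra) :
    ‖τ.toL2 (α x)‖ = ‖τ.toL2 (VonNeumannAlgebra.incl hNM x)‖ := by
  refine (sq_eq_sq₀ (norm_nonneg _) (norm_nonneg _)).1 ?_
  rw [τ.norm_toL2_sq, τ.norm_toL2_sq, ← map_star, ← map_mul, hα, map_mul, map_star]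

/-- The span of a self-adjoint multiplicative set `G ∋ 1` in `N` is `‖·‖₂`-dense in its
bicommutant. -/
theorem exists_mem_span_norm_toL2_sub_lt (hNM : N ≤ M) (τ : TracialState M)
    {G : Set (K →L[ℂ] K)} (hGN : ∀ g ∈ G, g ∈ N) (h1 : 1 ∈ G)
    (hmul : ∀ a ∈ G, ∀ b ∈ G, a * b ∈ G) (hstar : ∀ a ∈ G, star a ∈ G)
    {x : N.toStarSubalgebra} (hx : (x : K →L[ℂ] K) ∈ G.centralizer.centralizer)
    {ε : ℝ} (hε : 0 < ε) :
    ∃ s ∈ Submodule.span ℂ {y : N.toStarSubalgebra | (y : K →L[ℂ] K) ∈ G},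
      ‖τ.toL2 (VonNeumannAlgebra.incl hNM (x - s))‖ < ε := by
  -- The vectors representing the normal trace identify ‖x - s‖₂² with ∑ ‖(x - s) ξₙ‖².
  obtain ⟨ξ, hξ, hsum⟩ := τ.normal
  obtain ⟨s, hs, hlt⟩ := exists_mem_span_tsum_lt_of_mem_bicommutant h1 hmul hstar hx hξ hε
  have hs' : ∃ s' ∈ Submodule.span ℂ {y : N.toStarSubalgebra | (y : K →L[ℂ] K) ∈ G},
      (s' : K →L[ℂ] K) = s := by
    have hle : Submodule.span ℂ G ≤
        (Submodule.span ℂ {y : N.toStarSubalgebra | (y : K →L[ℂ] K) ∈ G}).map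
          N.toStarSubalgebra.toSubalgebra.val.toLinearMap :=
      Submodule.span_le.2 fun g hg => ⟨⟨g, hGN g hg⟩, Submodule.subset_span hg, rfl⟩
    exact hle hs
  obtain ⟨s', hs', rfl⟩ := hs'
  refine ⟨s', hs', lt_of_pow_lt_pow_left₀ 2 hε.le ?_⟩
  have h := Complex.hasSum_re (hsum (star (VonNeumannAlgebra.incl hNM (x - s')) *
    VonNeumannAlgebra.incl hNM (x - s')))
  rw [τ.norm_toL2_sq, ← h.tsum_eq]
  refine lt_of_eq_of_lt (tsum_congr fun n => ?_) hlt
  rw [← inner_self_eq_norm_sq (𝕜 := ℂ), ← ContinuousLinearMap.adjoint_inner_right]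
  rfl

/-- If a trace preserving `*`-homomorphism `α : N → M` is `c`-close to the identity in `‖·‖₂` on a
group `G` of unitaries, then it is `2c`-close to the identity on the unit ball of the
bicommutant of `G`. -/
theorem norm_toL2_starAlgHom_sub_le_of_mem_bicommutant (hNM : N ≤ M) (τ : TracialState M)
    {α : N.toStarSubalgebra →⋆ₐ[ℂ] M.toStarSubalgebra}
    (hα : ∀ x, τ (α x) = τ (VonNeumannAlgebra.incl hNM x))
    {G : Set (K →L[ℂ] K)} (hGN : ∀ g ∈ G, g ∈ N) (hG : G ⊆ unitary (K →L[ℂ] K)) (h1 : 1 ∈ G)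
    (hmul : ∀ a ∈ G, ∀ b ∈ G, a * b ∈ G) (hstar : ∀ a ∈ G, star a ∈ G) {c : ℝ}
    (hc : ∀ u : N.toStarSubalgebra, (u : K →L[ℂ] K) ∈ G →
      ‖τ.toL2 (α u) - τ.toL2 (VonNeumannAlgebra.incl hNM u)‖ ≤ c)
    {x : N.toStarSubalgebra} (hx : (x : K →L[ℂ] K) ∈ G.centralizer.centralizer) (hx1 : ‖x‖ ≤ 1) :
    ‖τ.toL2 (α x) - τ.toL2 (VonNeumannAlgebra.incl hNM x)‖ ≤ 2 * c := by
  set i := VonNeumannAlgebra.incl hNM with hi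
  let G' : Set N.toStarSubalgebra := {y | (y : K →L[ℂ] K) ∈ G}
  have hGu : ∀ u ∈ G', u ∈ unitary N.toStarSubalgebra := fun u hu =>
    ⟨Subtype.ext (hG hu).1, Subtype.ext (hG hu).2⟩
  have hiu : ∀ u ∈ G', i u ∈ unitary M.toStarSubalgebra := fun u hu => Unitary.map_mem i (hGu u hu)
  have hαu : ∀ u ∈ G', α u ∈ unitary M.toStarSubalgebra := fun u hu => Unitary.map_mem α (hGu u hu)
  let S : Set τ.L2 := (fun u => τ.toL2 (star (i u) * α u)) '' G'
  have hS1 : S.Nonempty := ⟨_, 1, h1, rfl⟩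
  have hSc : S ⊆ Metric.closedBall (τ.toL2 1) c := by
    rintro _ ⟨u, hu, rfl⟩
    rw [mem_closedBall_iff_norm, ← map_sub]
    have h : star (i u) * α u - 1 = star (i u) * (α u - i u) := by
      rw [mul_sub, Unitary.star_mul_self_of_mem (hiu u hu)]
    rw [h]
    refine (τ.norm_toL2_mul_le_left _ _).trans ?_
    have h2 := TracialState.norm_le_one_of_mem_unitary (Unitary.star_mem (hiu u hu))
    have h3 := hc u hu
    rw [← map_sub] at h3
    exact (mul_le_of_le_one_left (norm_nonneg _) h2).trans h3
  -- The contraction η ↦ u* η α(u) sends v* α(v) to (vu)* α(vu), so it preserves S; a fixed vector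
  -- satisfies u ξ = ξ α(u).
  obtain ⟨ξ, hξ, hfix⟩ := exists_fixed_mem_closedBall hS1 hSc
    (fun u : G' => τ.leftMul (star (i u)) ∘L τ.rightMul (α u))
    (fun u ξ => by
      have h2 := TracialState.norm_le_one_of_mem_unitary (Unitary.star_mem (hiu u u.2))
      have h3 := TracialState.norm_le_one_of_mem_unitary (hαu u u.2)
      refine (τ.norm_leftMul_apply_le _ _).trans ((mul_le_of_le_one_left (norm_nonneg _) h2).trans ?_)
      exact (τ.norm_rightMul_apply_le _ _).trans (mul_le_of_le_one_left (norm_nonneg _) h3))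
    (by
      rintro ⟨u, hu⟩ _ ⟨v, hv, rfl⟩
      refine ⟨v * u, hmul _ hv _ hu, ?_⟩
      simp [TracialState.leftMul_toL2, TracialState.rightMul_toL2, mul_assoc])
  have hGξ : ∀ u ∈ Submodule.span ℂ G', τ.leftMul (i u) ξ = τ.rightMul (α u) ξ := by
    intro u hu
    induction hu using Submodule.span_induction with
    | mem u hu =>
      have h := congr_arg (τ.leftMul (i u)) (hfix ⟨u, hu⟩)
      simp only [ContinuousLinearMap.comp_apply, τ.leftMul_leftMul,
        Unitary.mul_star_self_of_mem (hiu u hu), τ.leftMul_one,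
        ContinuousLinearMap.id_apply] at h
      exact h.symm
    | zero =>
      have h := τ.leftMul_smul 0 0
      have h' := τ.rightMul_smul 0 0
      rw [zero_smul, zero_smul] at h h'
      rw [map_zero, map_zero, h, h']
    | add s t _ _ h₁ h₂ => simp [τ.leftMul_add, τ.rightMul_add, h₁, h₂]
    | smul c s _ h => simp [τ.leftMul_smul, τ.rightMul_smul, h]
  have hxξ : τ.leftMul (i x) ξ = τ.rightMul (α x) ξ := by
    rw [← sub_eq_zero]
    refine τ.denseRange_toL2.eq_zero_of_inner_right (𝕜 := ℂ) fun y => ?_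
    rw [← norm_le_zero_iff]
    refine le_of_forall_pos_le_add fun ε hε => ?_
    -- The left and right errors each cost ‖y‖ ‖ξ‖, since α preserves the 2-norm; the 1 avoids
    -- division by zero.
    have hpos : 0 < 2 * (‖y‖ * ‖ξ‖) + 1 := by positivity
    obtain ⟨s, hs, hlt⟩ := exists_mem_span_norm_toL2_sub_lt hNM τ hGN h1 hmul hstar hx
      (div_pos hε hpos)
    have hsplit : τ.leftMul (i x) ξ - τ.rightMul (α x) ξ =
        τ.leftMul (i (x - s)) ξ - τ.rightMul (α (x - s)) ξ := by
      have e : x = (x - s) + s := by abel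
      conv_lhs => rw [e]
      rw [map_add, map_add, τ.leftMul_add, τ.rightMul_add]
      simp [hGξ s hs]
    rw [hsplit, inner_sub_right]
    have hl := τ.norm_inner_toL2_leftMul_le (i (x - s)) y ξ
    have hr := τ.norm_inner_toL2_rightMul_le (α (x - s)) y ξ
    rw [norm_toL2_starAlgHom hNM τ hα] at hr
    rw [lt_div_iff₀ hpos] at hlt
    refine (norm_sub_le _ _).trans ?_
    have := norm_nonneg (τ.toL2 (i (x - s)))
    linarith
  have hd : τ.toL2 (α x) - τ.toL2 (i x) =
      τ.leftMul (i x) (ξ - τ.toL2 1) - τ.rightMul (α x) (ξ - τ.toL2 1) := by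
    rw [map_sub, map_sub, hxξ, τ.leftMul_toL2, τ.rightMul_toL2, mul_one, one_mul]
    abel
  rw [hd]
  rw [mem_closedBall_iff_norm] at hξ
  have hl := τ.norm_leftMul_apply_le (i x) (ξ - τ.toL2 1)
  have hr := τ.norm_rightMul_apply_le (α x) (ξ - τ.toL2 1)
  have hix : ‖i x‖ ≤ 1 := hx1
  have hαx : ‖α x‖ ≤ 1 := (VonNeumannAlgebra.norm_starAlgHom_apply_le α x).trans hx1
  have hl' := hl.trans (mul_le_of_le_one_left (norm_nonneg _) hix)
  have hr' := hr.trans (mul_le_of_le_one_left (norm_nonneg _) hαx)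
  refine (norm_sub_le _ _).trans ?_
  linarith

/-! ### Dilations of symmetric semigroups. -/

theorem IsDilation.map_one {hNM : N ≤ M} {τ : TracialState M}
    {α : ℝ≥0 → N.toStarSubalgebra →⋆ₐ[ℂ] M.toStarSubalgebra}
    {φ : ℝ≥0 → N.toStarSubalgebra →ₗ[ℂ] N.toStarSubalgebra} (hα : IsDilation hNM τ α φ)
    (t : ℝ≥0) : VonNeumannAlgebra.incl hNM (φ t 1) = 1 := by
  apply τ.toL2_injective
  rw [← hα t 1, _root_.map_one, TracialState.condExp]
  exact Submodule.starProjection_eq_self_iff.2 (τ.toL2_mem_subL2 (one_mem N))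

/-- Pairing with an element of N sees only the projection of α_t(x) onto L²(N), which is φ_t(x). -/
theorem IsDilation.trace_mul {hNM : N ≤ M} {τ : TracialState M}
    {α : ℝ≥0 → N.toStarSubalgebra →⋆ₐ[ℂ] M.toStarSubalgebra}
    {φ : ℝ≥0 → N.toStarSubalgebra →ₗ[ℂ] N.toStarSubalgebra} (hα : IsDilation hNM τ α φ)
    (t : ℝ≥0) (x y : N.toStarSubalgebra) :
    τ (VonNeumannAlgebra.incl hNM y * α t x) = τ (VonNeumannAlgebra.incl hNM (y * φ t x)) := by
  have hy : ((star (VonNeumannAlgebra.incl hNM y) : M.toStarSubalgebra) : K →L[ℂ] K) ∈ N :=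
    (star y).2
  have h := τ.inner_condExp hy (α t x)
  rw [hα, τ.inner_toL2, star_star] at h
  rw [← h, map_mul (VonNeumannAlgebra.incl hNM)]

/-- α_t preserves adjoints, so both sides have the same trace pairing with every y ∈ N; faithfulness
then identifies them. -/
theorem IsDilation.map_star {hNM : N ≤ M} {τ : TracialState M}
    {α : ℝ≥0 → N.toStarSubalgebra →⋆ₐ[ℂ] M.toStarSubalgebra}
    {φ : ℝ≥0 → N.toStarSubalgebra →ₗ[ℂ] N.toStarSubalgebra} (hα : IsDilation hNM τ α φ)
    (t : ℝ≥0) (x : N.toStarSubalgebra) : φ t (star x) = star (φ t x) := by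
  set i := VonNeumannAlgebra.incl hNM with hi
  have key : ∀ y, τ (i (y * φ t (star x))) = τ (i (y * star (φ t x))) := by
    intro y
    have h := hα.trace_mul t x (star y)
    have h' := congr_arg star h
    rw [← τ.trace_star, ← τ.trace_star] at h'
    rw [← hα.trace_mul, StarHomClass.map_star, τ.map_mul_comm, map_mul i, τ.map_mul_comm (i y)]
    simpa [star_mul, hi, StarHomClass.map_star (VonNeumannAlgebra.incl hNM)] using h'
  have hinj : Function.Injective i := StarSubalgebra.inclusion_injective hNM
  rw [← sub_eq_zero]
  apply hinj
  rw [map_zero]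
  apply τ.faithful
  rw [← StarHomClass.map_star, ← map_mul, mul_sub, map_sub, map_sub, key, sub_self]

/-- Combine τ ∘ α_t = τ ∘ φ_t with the symmetry of φ_t tested against φ_t(1) = 1. -/
theorem IsDilation.trace_apply {hNM : N ≤ M} {τ : TracialState M}
    {α : ℝ≥0 → N.toStarSubalgebra →⋆ₐ[ℂ] M.toStarSubalgebra}
    {φ : ℝ≥0 → N.toStarSubalgebra →ₗ[ℂ] N.toStarSubalgebra} (hα : IsDilation hNM τ α φ)
    (hφ : IsSymmetricSemigroup hNM τ φ) (t : ℝ≥0) (x : N.toStarSubalgebra) :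
    τ (α t x) = τ (VonNeumannAlgebra.incl hNM x) := by
  have h := hα.trace_mul t x 1
  have h' := hφ.symm t x 1
  rw [_root_.map_one, one_mul, one_mul] at h
  rw [mul_one, map_mul, hα.map_one, mul_one] at h'
  rw [h, h']

/-- The transversality identity `‖α_{2t}(x) - x‖₂² = 2 ‖α_t(x) - φ_t(x)‖₂²`. -/
theorem IsDilation.norm_sq_sub_eq {hNM : N ≤ M} {τ : TracialState M}
    {α : ℝ≥0 → N.toStarSubalgebra →⋆ₐ[ℂ] M.toStarSubalgebra}
    {φ : ℝ≥0 → N.toStarSubalgebra →ₗ[ℂ] N.toStarSubalgebra} (hα : IsDilation hNM τ α φ)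
    (hφ : IsSymmetricSemigroup hNM τ φ) (t : ℝ≥0) (x : N.toStarSubalgebra) :
    ‖τ.toL2 (α (t + t) x) - τ.toL2 (VonNeumannAlgebra.incl hNM x)‖ ^ 2 =
      2 * ‖τ.toL2 (α t x - VonNeumannAlgebra.incl hNM (φ t x))‖ ^ 2 := by
  set i := VonNeumannAlgebra.incl hNM with hi
  have hn := fun s => norm_toL2_starAlgHom hNM τ (hα.trace_apply hφ s) x
  have hin : ∀ s, ∀ y, ⟪τ.toL2 (i y), τ.toL2 (α s x)⟫_ℂ = τ (i (star y * φ s x)) := by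
    intro s y
    rw [τ.inner_toL2, ← StarHomClass.map_star, hα.trace_mul]
  -- Splitting φ_{2t} = φ_t φ_t and moving one factor across the trace gives ‖φ_t(x)‖₂². Both sides
  -- of the identity then equal 2(‖x‖₂² - ‖φ_t(x)‖₂²).
  have h1 : ⟪τ.toL2 (i x), τ.toL2 (α (t + t) x)⟫_ℂ = ⟪τ.toL2 (i (φ t x)), τ.toL2 (i (φ t x))⟫_ℂ := by
    rw [hin, hφ.add, LinearMap.comp_apply, ← hφ.symm, hα.map_star, τ.inner_toL2, map_mul,
      StarHomClass.map_star]
  have h2 : ⟪τ.toL2 (i (φ t x)), τ.toL2 (α t x)⟫_ℂ =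
      ⟪τ.toL2 (i (φ t x)), τ.toL2 (i (φ t x))⟫_ℂ := by
    rw [hin, τ.inner_toL2, map_mul, StarHomClass.map_star]
  rw [map_sub, norm_sub_rev, norm_sub_rev (τ.toL2 (α t x)), norm_sub_sq (𝕜 := ℂ),
    norm_sub_sq (𝕜 := ℂ), h1, h2, inner_self_eq_norm_sq, hn, hn]
  ring

/-! ### The normalizer and the relative compactness estimate. -/

theorem norm_le_norm_add_of_inner_eq_zero {E : Type*} [NormedAddCommGroup E]
    [InnerProductSpace ℂ E] {a b : E} (h : ⟪a, b⟫_ℂ = 0) : ‖b‖ ≤ ‖a + b‖ := by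
  have := norm_add_sq_eq_norm_sq_add_norm_sq_of_inner_eq_zero a b h
  nlinarith [norm_nonneg a, norm_nonneg b, norm_nonneg (a + b)]

theorem one_mem_normalizerSet (N A : VonNeumannAlgebra K) : 1 ∈ normalizerSet N A :=
  ⟨one_mem N, one_mem _, by simp⟩

theorem mul_mem_normalizerSet {N A : VonNeumannAlgebra K} {u v : K →L[ℂ] K}
    (hu : u ∈ normalizerSet N A) (hv : v ∈ normalizerSet N A) : u * v ∈ normalizerSet N A := by
  refine ⟨mul_mem hu.1 hv.1, mul_mem hu.2.1 hv.2.1, ?_⟩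
  conv_rhs => rw [← hu.2.2, ← hv.2.2, Set.image_image]
  simp [mul_assoc]

theorem star_mem_normalizerSet {N A : VonNeumannAlgebra K} {u : K →L[ℂ] K}
    (hu : u ∈ normalizerSet N A) : star u ∈ normalizerSet N A := by
  refine ⟨star_mem hu.1, Unitary.star_mem hu.2.1, ?_⟩
  conv_lhs => rw [← hu.2.2, Set.image_image]
  have h : ∀ a, star u * (u * a * star u) * star (star u) = a := by
    intro a
    rw [star_star, mul_assoc, mul_assoc (u * a), Unitary.star_mul_self_of_mem hu.2.1, mul_one,
      ← mul_assoc, Unitary.star_mul_self_of_mem hu.2.1, one_mul]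
  simp only [h, Set.image_id']

/-- If `α_t` is `ε`-close to the identity on the unit ball of `A`, then `α_t - φ_t` is bounded by
`2ε` on the normalizer of `A`. -/
theorem norm_toL2_sub_le_of_mem_normalizerSet {A B : VonNeumannAlgebra K} (hNM : N ≤ M)
    (hAN : A ≤ N) (τ : TracialState M) {H : Submodule ℂ τ.L2} (hH : τ.IsHilbertBimodule N H)
    (hHN : H ≤ (τ.subL2 N)ᗮ) (hcomp : τ.IsCompactRelative A B N H)
    (hAB : ¬ τ.EmbedsInside A B N) (α : N.toStarSubalgebra →⋆ₐ[ℂ] M.toStarSubalgebra)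
    {w y : N.toStarSubalgebra} (hy : τ.toL2 (α w - VonNeumannAlgebra.incl hNM y) ∈ H)
    (hw : (w : K →L[ℂ] K) ∈ normalizerSet N A) {ε : ℝ}
    (hε : ∀ x : N.toStarSubalgebra, (x : K →L[ℂ] K) ∈ A → ‖x‖ ≤ 1 →
      ‖τ.toL2 (α x) - τ.toL2 (VonNeumannAlgebra.incl hNM x)‖ ≤ ε) :
    ‖τ.toL2 (α w - VonNeumannAlgebra.incl hNM y)‖ ≤ 2 * ε := by
  set i := VonNeumannAlgebra.incl hNM with hi
  set δ := τ.toL2 (α w - i y) with hδ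
  have hwu : w ∈ unitary N.toStarSubalgebra := ⟨Subtype.ext hw.2.1.1, Subtype.ext hw.2.1.2⟩
  have hαw := TracialState.norm_le_one_of_mem_unitary (Unitary.map_mem α hwu)
  obtain ⟨u, hu, hu0⟩ := not_not.1 hAB
  let v : ℕ → N.toStarSubalgebra := fun k => ⟨u k, hAN (hu k).1⟩
  have hvu : ∀ k, v k ∈ unitary N.toStarSubalgebra := fun k =>
    ⟨Subtype.ext (congr_arg (Subtype.val : M.toStarSubalgebra → K →L[ℂ] K) (hu k).2.1),
      Subtype.ext (congr_arg (Subtype.val : M.toStarSubalgebra → K →L[ℂ] K) (hu k).2.2)⟩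
  have hconjA : ∀ k, ((w * v k * star w : N.toStarSubalgebra) : K →L[ℂ] K) ∈ A := fun k =>
    (Set.ext_iff.1 hw.2.2 _).1 ⟨u k, (hu k).1, rfl⟩
  have hconjU : ∀ k, w * v k * star w ∈ unitary N.toStarSubalgebra := fun k =>
    mul_mem (mul_mem hwu (hvu k)) (Unitary.star_mem hwu)
  have hwmem : ∀ z : N.toStarSubalgebra, ((i z : M.toStarSubalgebra) : K →L[ℂ] K) ∈ N := fun z => z.2
  -- Conjugation by w stays in A, and w, w* are absorbed into the test elements of N, so w u_k w* is
  -- still asymptotically null relative to B. The right-hand sequence is u_k*.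
  have hlim := hcomp (fun k => i (w * v k * star w))
    (fun k => ⟨hconjA k,
      TracialState.norm_le_one_of_mem_unitary (Unitary.map_mem i (hconjU k))⟩)
    (fun a b ha hb => by
      refine (hu0 (star (a * i w)) (star (i w) * b)
        (star_mem (mul_mem ha w.2)) (mul_mem (star_mem w.2) hb)).congr fun k => ?_
      have e : star (star (a * i w)) * u k * (star (i w) * b) = a * i (w * v k * star w) * b := by
        have : u k = i (v k) := rfl
        simp [this, mul_assoc, StarHomClass.map_star i]
      rw [e])
    (fun k => star (u k)) (fun k => ⟨star_mem (hu k).1,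
      TracialState.norm_le_one_of_mem_unitary (Unitary.star_mem (hu k).2)⟩) δ hy
  have hbound : ∀ k, ‖δ - τ.leftMul (i (w * v k * star w)) (τ.rightMul (star (u k)) δ)‖ ≤ 2 * ε := by
    intro k
    set a := w * v k * star w with ha
    have haw : a * w = w * v k := by
      rw [ha, mul_assoc, Unitary.star_mul_self_of_mem hwu, mul_one]
    have hvk : ‖v k‖ ≤ 1 := TracialState.norm_le_one_of_mem_unitary (hvu k)
    have hak : ‖a‖ ≤ 1 := TracialState.norm_le_one_of_mem_unitary (hconjU k)
    have huk : u k = i (v k) := rfl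
    -- `δ v - a δ` is the component of `α(w) v - a α(w)` orthogonal to `L²(N)`
    have hdec : τ.toL2 (α w * i (v k) - i a * α w) =
        τ.toL2 (i (y * v k - a * y)) + (τ.rightMul (i (v k)) δ - τ.leftMul (i a) δ) := by
      rw [hδ, τ.rightMul_toL2, τ.leftMul_toL2, ← map_sub, ← map_add, map_sub i, map_mul i y, map_mul i a y]
      congr 1
      noncomm_ring
    have horth : ⟪τ.toL2 (i (y * v k - a * y)), τ.rightMul (i (v k)) δ - τ.leftMul (i a) δ⟫_ℂ = 0 :=
      (Submodule.mem_orthogonal _ _).1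
        (hHN (sub_mem (hH.rightMul_mem _ (hwmem _) _ hy) (hH.leftMul_mem _ (hwmem _) _ hy))) _
        (τ.toL2_mem_subL2 (hwmem _))
    have h1 : ‖τ.rightMul (i (v k)) δ - τ.leftMul (i a) δ‖ ≤
        ‖τ.toL2 (α w * i (v k) - i a * α w)‖ := by
      rw [hdec]; exact norm_le_norm_add_of_inner_eq_zero horth
    have h2 : ‖τ.toL2 (α w * i (v k) - i a * α w)‖ ≤ 2 * ε := by
      -- Inserting α(a) α(w) = α(w) α(v) leaves two errors, each at most ε because a and v lie in
      -- (A)₁.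
      have e : α w * i (v k) - i a * α w = (α a - i a) * α w - α w * (α (v k) - i (v k)) := by
        have : α a * α w = α w * α (v k) := by rw [← map_mul, haw, map_mul]
        rw [sub_mul, mul_sub, this]
        abel
      rw [e, map_sub]
      have e1 := (τ.norm_toL2_mul_le_right (α a - i a) (α w)).trans
        (mul_le_of_le_one_left (norm_nonneg _) hαw)
      have e2 := (τ.norm_toL2_mul_le_left (α w) (α (v k) - i (v k))).trans
        (mul_le_of_le_one_left (norm_nonneg _) hαw)
      have e3 := hε a (hconjA k) hak
      have e4 := hε (v k) (hu k).1 hvk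
      rw [← map_sub] at e3 e4
      refine (norm_sub_le _ _).trans ?_
      linarith
    have h3 : δ - τ.leftMul (i a) (τ.rightMul (star (u k)) δ) =
        τ.rightMul (star (u k)) (τ.rightMul (i (v k)) δ - τ.leftMul (i a) δ) := by
      rw [map_sub, τ.rightMul_rightMul, ← huk, Unitary.mul_star_self_of_mem (hu k).2,
        τ.rightMul_one, τ.leftMul_rightMul_comm]
      rfl
    rw [h3]
    have h4 := TracialState.norm_le_one_of_mem_unitary (Unitary.star_mem (hu k).2)
    exact (τ.norm_rightMul_apply_le _ _).trans
      ((mul_le_of_le_one_left (norm_nonneg _) h4).trans (h1.trans h2))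
  have hsq : ‖δ‖ ^ 2 ≤ ‖δ‖ * (2 * ε) := by
    have hlim' : Tendsto (fun k => ‖δ‖ * (2 * ε) +
        ‖⟪δ, τ.leftMul (i (w * v k * star w)) (τ.rightMul (star (u k)) δ)⟫_ℂ‖) atTop
        (𝓝 (‖δ‖ * (2 * ε) + 0)) := by
      simpa using hlim.norm.const_add (‖δ‖ * (2 * ε))
    rw [add_zero] at hlim'
    refine ge_of_tendsto' hlim' fun k => ?_
    set ζ := τ.leftMul (i (w * v k * star w)) (τ.rightMul (star (u k)) δ)
    -- The first term is at most 2ε ‖δ‖; the second tends to 0 with k.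
    have e : (‖δ‖ : ℂ) ^ 2 = ⟪δ, δ - ζ⟫_ℂ + ⟪δ, ζ⟫_ℂ := by
      rw [← inner_add_right, sub_add_cancel, inner_self_eq_norm_sq_to_K]
      rfl
    have e' : ‖δ‖ ^ 2 = ‖⟪δ, δ - ζ⟫_ℂ + ⟪δ, ζ⟫_ℂ‖ := by
      rw [← e]; simp
    rw [e']
    refine (norm_add_le _ _).trans ?_
    have := (norm_inner_le_norm (𝕜 := ℂ) δ (δ - ζ)).trans
      (mul_le_mul_of_nonneg_left (hbound k) (norm_nonneg δ))
    linarith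
  rcases (norm_nonneg δ).eq_or_lt with h0 | h0
  · rw [← h0]
    -- When δ = 0 only ε ≥ 0 is needed, and the bound at 0 ∈ A gives it.
    have := (norm_nonneg _).trans (hε 0 (zero_mem A) (by simp))
    linarith
  · rw [sq] at hsq
    exact le_of_mul_le_mul_left hsq h0

end Deformation

/-! ### Uniform convergence on the algebra generated by the normalizer. -/

theorem theorem5p3 {K : Type*} [NormedAddCommGroup K] [InnerProductSpace ℂ K] [CompleteSpace K]
    (M N A B : VonNeumannAlgebra K) (hNM : N ≤ M) (hAN : A ≤ N) (hBN : B ≤ N)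
    (τ : TracialState M)
    (H : Submodule ℂ τ.L2) (hH : τ.IsHilbertBimodule N H) (hHN : H ≤ (τ.subL2 N)ᗮ)
    (hcomp : τ.IsCompactRelative A B N H)
    (φ : ℝ≥0 → N.toStarSubalgebra →ₗ[ℂ] N.toStarSubalgebra)
    (hφ : IsSymmetricSemigroup hNM τ φ)
    (α : ℝ≥0 → N.toStarSubalgebra →⋆ₐ[ℂ] M.toStarSubalgebra)
    (hα : IsDilation hNM τ α φ)
    (hrange : ∀ t x, τ.toL2 (α t x - VonNeumannAlgebra.incl hNM (φ t x)) ∈ H)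
    (hAB : ¬ τ.EmbedsInside A B N)
    (hA : ConvergesUniformlyOnBall hNM τ α A) :
    ConvergesUniformlyOnBall hNM τ α (normalizerSet N A).centralizer.centralizer := by
  rw [ConvergesUniformlyOnBall, Metric.tendstoUniformlyOn_iff] at hA ⊢
  intro ε hε
  -- Transversality doubles time, so closeness on A is used at t/2.
  have hhalf : Tendsto (fun t : ℝ≥0 => t / 2) (𝓝[>] 0) (𝓝[>] 0) := by
    refine tendsto_nhdsWithin_of_tendsto_nhds_of_eventually_within _ ?_ ?_
    · have h : Tendsto (fun t : ℝ≥0 => t / 2) (𝓝 0) (𝓝 (0 / 2)) :=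
        Continuous.tendsto (by fun_prop) 0
      rw [zero_div] at h
      exact h.mono_left nhdsWithin_le_nhds
    · filter_upwards [self_mem_nhdsWithin] with t ht
      exact half_pos (Set.mem_Ioi.1 ht)
  -- The constants are 2 from compactness, then √2 from transversality with 2√2 ≤ 3, then 2 from
  -- averaging: 6ε/8 < ε.
  filter_upwards [hhalf.eventually (hA (ε / 8) (by positivity))] with t ht x hx
  have hδ : ∀ w : N.toStarSubalgebra, (w : K →L[ℂ] K) ∈ normalizerSet N A →
      ‖τ.toL2 (α (t / 2) w - VonNeumannAlgebra.incl hNM (φ (t / 2) w))‖ ≤ 2 * (ε / 8) := by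
    intro w hw
    refine norm_toL2_sub_le_of_mem_normalizerSet hNM hAN τ hH hHN hcomp hAB (α (t / 2))
      (hrange _ _) hw fun y hy hy1 => ?_
    have := ht y ⟨hy, hy1⟩
    rw [dist_eq_norm, norm_sub_rev] at this
    exact this.le
  have hc : ∀ w : N.toStarSubalgebra, (w : K →L[ℂ] K) ∈ normalizerSet N A →
      ‖τ.toL2 (α t w) - τ.toL2 (VonNeumannAlgebra.incl hNM w)‖ ≤ 3 * (ε / 8) := by
    intro w hw
    have h := hα.norm_sq_sub_eq hφ (t / 2) w
    rw [add_halves] at h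
    refine le_of_sq_le_sq ?_ (by positivity)
    rw [h]
    nlinarith [hδ w hw, norm_nonneg (τ.toL2 (α (t / 2) w - VonNeumannAlgebra.incl hNM (φ (t / 2) w)))]
  have h := norm_toL2_starAlgHom_sub_le_of_mem_bicommutant hNM τ (hα.trace_apply hφ t)
    (fun g hg => hg.1) (fun g hg => hg.2.1) (one_mem_normalizerSet N A)
    (fun a ha b hb => mul_mem_normalizerSet ha hb) (fun a ha => star_mem_normalizerSet ha)
    hc hx.1 hx.2
  rw [dist_eq_norm, norm_sub_rev]
  linarith
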